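/- Let $n\ge 1$ be an integer and let $k\ge 1$ be a real number. Let $S^n\subset\mathbb R^{n+1}$ be the unit sphere with its standard metric and surface measure, $\Delta$ its Laplace--Beltrami operator (acting as a self-adjoint operator on the real space $L^2(S^n)$), and $H^k=H^k(S^n)$ the $L^2$-based Sobolev space with norm $\|\xi\|_{H^k}=\|(1-\Delta)^{k/2}\xi\|_{L^2(S^n)}$. For $a>0$ put $L_a=\frac an(-\Delta-2n)$ and $$\Lambda_k(\xi)=\tfrac12\langle \xi, L_a^k\,\xi\rangle ,$$ where $\langle\cdot,\cdot\rangle$ is the $L^2(S^n)$ inner product and $\langle\xi,L_a^k\xi\rangle$ is understood as the quadratic form of $L_a^k$, defined by the spectral calculus of $-\Delta$. Then there exist constants $c>0$ and $C>0$, depending only on $n$ and $k$, such that for every $a>0$ and every real-valued $\xi\in H^k(S^n)$ that is orthogonal in $L^2(S^n)$ to the constant function $1$ and to the coordinate functions $\omega^1,\dots,\omega^{n+1}$, the form $\langle\xi,L_a^k\xi\rangle$ is well defined (finite) and $$c\,a^k\|\xi\|_{H^k}^2\;\le\;\Lambda_k(\xi)\;\le\;C\,a^k\|\xi\|_{H^k}^2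 .$$ -/

import Mathlib

open scoped Manifold ContDiff

noncomputable section

namespace RoundSphere

/-- The unit sphere `S^n` in `ℝ^{n+1}`. -/
abbrev S (n : ℕ) : Type := Metric.sphere (0 : EuclideanSpace ℝ (Fin (n + 1))) 1

/-- The surface measure of `S^n`. -/
abbrev surfaceMeasure (n : ℕ) : MeasureTheory.Measure (S n) :=
  (MeasureTheory.volume : MeasureTheory.Measure (EuclideanSpace ℝ (Fin (n + 1)))).toSphere

/-- The real Hilbert space `L²(S^n)`. -/
abbrev L2 (n : ℕ) : Type := MeasureTheory.Lp ℝ 2 (surfaceMeasure n)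

/-- `C^∞` functions on the manifold `S^n`. -/
def IsSmooth {n : ℕ} (φ : S n → ℝ) : Prop := ContMDiff (𝓡 n) 𝓘(ℝ, ℝ) ∞ φ

/-- The extension of a function on `S^n` to `ℝ^{n+1} ∖ {0}` that is constant along rays,
`y ↦ φ (y / |y|)` (with the irrelevant value `0` at the origin). -/
def radialExtension {n : ℕ} (φ : S n → ℝ) (y : EuclideanSpace ℝ (Fin (n + 1))) : ℝ :=
  if hy : y = 0 then 0 else φ ⟨‖y‖⁻¹ • y, by simp [norm_smul, hy]⟩

/-- The Laplace–Beltrami operator of the standard metric of `S^n` on `C²` functions: the Euclidean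
Laplacian of the extension that is constant along rays, evaluated on the sphere. -/
def laplaceBeltrami {n : ℕ} (φ : S n → ℝ) (x : S n) : ℝ :=
  Laplacian.laplacian (radialExtension φ) (x : EuclideanSpace ℝ (Fin (n + 1)))

/-- `f ∈ L²(S^n)` has the weak (distributional) Laplacian `g ∈ L²(S^n)`. -/
def HasWeakLaplacian {n : ℕ} (f g : L2 n) : Prop :=
  ∀ φ : S n → ℝ, IsSmooth φ →
    ∫ x, f x * laplaceBeltrami φ x ∂(surfaceMeasure n) = ∫ x, g x * φ x ∂(surfaceMeasure n)

theorem IsSmooth.contDiffAt_radialExtension {n : ℕ} {φ : S n → ℝ} (hφ : IsSmooth φ)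
    {y : EuclideanSpace ℝ (Fin (n + 1))} (hy : y ≠ 0) : ContDiffAt ℝ ∞ (radialExtension φ) y := by
  have := Fact.mk (@finrank_euclideanSpace_fin ℝ _ (n + 1))
  let U : TopologicalSpace.Opens (EuclideanSpace ℝ (Fin (n + 1))) := ⟨{0}ᶜ, isOpen_compl_singleton⟩
  have hU : ∀ u : U, (u : EuclideanSpace ℝ (Fin (n + 1))) ≠ 0 := fun u => u.2
  have h1 : ContMDiff 𝓘(ℝ, EuclideanSpace ℝ (Fin (n + 1))) 𝓘(ℝ, EuclideanSpace ℝ (Fin (n + 1))) ∞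
      (fun u : U => ‖(u : EuclideanSpace ℝ (Fin (n + 1)))‖⁻¹ •
        (u : EuclideanSpace ℝ (Fin (n + 1)))) := by
    intro u
    have h : ContDiffAt ℝ ∞ (fun z : EuclideanSpace ℝ (Fin (n + 1)) => ‖z‖⁻¹ • z) u :=
      ((contDiffAt_norm ℝ (hU u)).inv (norm_ne_zero_iff.2 (hU u))).smul contDiffAt_id
    exact (contMDiffAt_subtype_iff (f := fun z : EuclideanSpace ℝ (Fin (n + 1)) => ‖z‖⁻¹ • z)).2
      h.contMDiffAt
  have h2 := h1.codRestrict_sphere (n := n)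
    (fun u => by simp [norm_smul, hU u])
  have h3 : ContMDiff 𝓘(ℝ, EuclideanSpace ℝ (Fin (n + 1))) 𝓘(ℝ, ℝ) ∞
      (fun u : U => radialExtension φ u) := by
    have h4 := ContMDiff.comp (g := φ) hφ h2
    refine h4.congr fun u => ?_
    simp only [radialExtension, dif_neg (hU u)]
    rfl
  exact (contMDiffAt_subtype_iff.1 (h3 ⟨y, hy⟩)).contDiffAt

theorem IsSmooth.continuous {n : ℕ} {φ : S n → ℝ} (hφ : IsSmooth φ) : Continuous φ :=
  ContMDiff.continuous hφ

theorem IsSmooth.continuous_laplaceBeltrami {n : ℕ} {φ : S n → ℝ} (hφ : IsSmooth φ) :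
    Continuous (laplaceBeltrami φ) := by
  rw [continuous_iff_continuousAt]
  intro x
  have hx : (x : EuclideanSpace ℝ (Fin (n + 1))) ≠ 0 := ne_zero_of_mem_unit_sphere x
  have h : ContinuousAt (Laplacian.laplacian (radialExtension φ))
      (x : EuclideanSpace ℝ (Fin (n + 1))) := by
    rw [InnerProductSpace.laplacian_eq_iteratedFDeriv_stdOrthonormalBasis]
    have h2 : ContinuousAt (iteratedFDeriv ℝ 2 (radialExtension φ))
        (x : EuclideanSpace ℝ (Fin (n + 1))) :=
      ((hφ.contDiffAt_radialExtension hx).iteratedFDeriv_right (m := 0) (i := 2)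
        (by norm_cast)).continuousAt
    refine tendsto_finsetSum _ fun i _ => ?_
    let b := stdOrthonormalBasis ℝ (EuclideanSpace ℝ (Fin (n + 1)))
    have h3 := (ContinuousMultilinearMap.apply ℝ
      (fun _ : Fin 2 => EuclideanSpace ℝ (Fin (n + 1))) ℝ ![b i, b i]).continuous
    exact h3.continuousAt.comp h2
  exact ContinuousAt.comp (f := Subtype.val) h continuous_subtype_val.continuousAt

theorem memLp_of_continuous {n : ℕ} {g : S n → ℝ} (hg : Continuous g) :
    MeasureTheory.MemLp g 2 (surfaceMeasure n) := by
  obtain ⟨C, hC⟩ := isCompact_univ.exists_bound_of_continuousOn hg.continuousOn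
  exact MeasureTheory.MemLp.of_bound hg.aestronglyMeasurable C
    (Filter.Eventually.of_forall fun x => hC x (Set.mem_univ x))

theorem integral_mul_eq_inner {n : ℕ} (f : L2 n) {g : S n → ℝ} (hg : Continuous g) :
    ∫ x, f x * g x ∂(surfaceMeasure n) = inner ℝ ((memLp_of_continuous hg).toLp g) f := by
  rw [MeasureTheory.L2.inner_def]
  refine MeasureTheory.integral_congr_ae ?_
  filter_upwards [(memLp_of_continuous hg).coeFn_toLp] with x hx
  simp [hx]

theorem hasWeakLaplacian_iff {n : ℕ} (f g : L2 n) :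
    HasWeakLaplacian f g ↔ ∀ φ : S n → ℝ, ∀ hφ : IsSmooth φ,
      inner ℝ ((memLp_of_continuous hφ.continuous_laplaceBeltrami).toLp _) f =
        inner ℝ ((memLp_of_continuous hφ.continuous).toLp _) g := by
  refine forall_congr' fun φ => forall_congr' fun hφ => ?_
  rw [integral_mul_eq_inner f hφ.continuous_laplaceBeltrami, integral_mul_eq_inner g hφ.continuous]

/-- The eigenspace of the self-adjoint operator `-Δ` on `L²(S^n)` for `μ`: all `f ∈ L²(S^n)` with
`-Δ f = μ f` (it is `{0}` if `μ` is not an eigenvalue). -/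
def eigenspace (n : ℕ) (μ : ℝ) : Submodule ℝ (L2 n) where
  carrier := {f | HasWeakLaplacian f (-(μ • f))}
  zero_mem' := by
    rw [Set.mem_ofPred_eq, hasWeakLaplacian_iff]
    intro φ hφ
    simp
  add_mem' := by
    intro f g hf hg
    rw [Set.mem_ofPred_eq, hasWeakLaplacian_iff] at *
    intro φ hφ
    have h1 := hf φ hφ
    have h2 := hg φ hφ
    rw [inner_neg_right, inner_smul_right] at *
    rw [inner_add_right, inner_add_right, h1, h2]
    ring
  smul_mem' := by
    intro c f hf
    rw [Set.mem_ofPred_eq, hasWeakLaplacian_iff] at *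
    intro φ hφ
    have h1 := hf φ hφ
    rw [inner_neg_right, inner_smul_right] at *
    rw [inner_smul_right, inner_smul_right, h1]
    ring

theorem isClosed_eigenspace (n : ℕ) (μ : ℝ) : IsClosed (eigenspace n μ : Set (L2 n)) := by
  have h : (eigenspace n μ : Set (L2 n)) = {f | HasWeakLaplacian f (-(μ • f))} := rfl
  rw [h]
  simp only [hasWeakLaplacian_iff, Set.ofPred_forall]
  refine isClosed_iInter fun φ => isClosed_iInter fun hφ => ?_
  exact isClosed_eq (by fun_prop) (by fun_prop)

instance completeSpace_eigenspace (n : ℕ) (μ : ℝ) : CompleteSpace (eigenspace n μ) :=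
  (isClosed_eigenspace n μ).completeSpace_coe

/-- `P_μ`, the orthogonal projection of `L²(S^n)` onto the eigenspace of `-Δ` for `μ`, that is,
the spectral projection of `-Δ` for `{μ}`. -/
def spectralProj (n : ℕ) (μ : ℝ) : L2 n →L[ℝ] L2 n := (eigenspace n μ).starProjection

/-- The spectrum of `-Δ` on `S^n` is discrete, so the spectral measure of `-Δ` at `ξ` is
`∑_μ ‖P_μ ξ‖² δ_μ`, and `⟨ξ, F(-Δ) ξ⟩ = ∑_μ F(μ) ‖P_μ ξ‖²`, where only the eigenvalues
`μ` of `-Δ` contribute. `InFormDomain F ξ` says that this sum converges absolutely. -/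
def InFormDomain {n : ℕ} (F : ℝ → ℝ) (ξ : L2 n) : Prop :=
  Summable fun μ : ℝ => F μ * ‖spectralProj n μ ξ‖ ^ 2

/-- The quadratic form `⟨ξ, F(-Δ) ξ⟩ = ∑_μ F(μ) ‖P_μ ξ‖²` of the operator `F(-Δ)`. -/
def spectralForm {n : ℕ} (F : ℝ → ℝ) (ξ : L2 n) : ℝ :=
  ∑' μ : ℝ, F μ * ‖spectralProj n μ ξ‖ ^ 2

/-- `ξ` is in the Sobolev space `H^k(S^n)`, the domain of `(1 - Δ)^{k/2}`. -/
def MemSobolev {n : ℕ} (k : ℝ) (ξ : L2 n) : Prop :=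
  InFormDomain (fun μ => (1 + μ) ^ k) ξ

/-- The norm `‖ξ‖_{H^k} = ‖(1 - Δ)^{k/2} ξ‖_{L²} = ⟨ξ, (1 - Δ)^k ξ⟩^{1/2}` of `H^k(S^n)`. -/
def sobolevNorm {n : ℕ} (k : ℝ) (ξ : L2 n) : ℝ :=
  Real.sqrt (spectralForm (fun μ => (1 + μ) ^ k) ξ)

/-- The function `F` with `F(-Δ) = L_a ^ k`, where `L_a = (a / n) (-Δ - 2 n)`. -/
def linearizedPow (n : ℕ) (a k : ℝ) (μ : ℝ) : ℝ := (a / n * (μ - 2 * n)) ^ k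

/-- The functional `Λ_k(ξ) = ½ ⟨ξ, L_a ^ k ξ⟩`. -/
def lyapunov {n : ℕ} (a k : ℝ) (ξ : L2 n) : ℝ :=
  1 / 2 * spectralForm (linearizedPow n a k) ξ

/-- `ξ` is orthogonal in `L²(S^n)` to `1` and to the coordinate functions `ω^1, …, ω^{n+1}`. -/
def OrthogonalToLowModes {n : ℕ} (ξ : L2 n) : Prop :=
  (∫ x, ξ x ∂(surfaceMeasure n) = 0) ∧
    ∀ j : Fin (n + 1),
      ∫ x, ξ x * (x : EuclideanSpace ℝ (Fin (n + 1))) j ∂(surfaceMeasure n) = 0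

end RoundSphere

end

noncomputable section

namespace RoundSphere

open MvPolynomial MeasureTheory

/-! Both forms are sums over `μ` against the same weights `‖P_μ ξ‖²`, so it is enough to compare the
two symbols wherever `P_μ ξ ≠ 0`. On `μ ≥ 2n + 2` the factor `μ - 2n` is comparable to `1 + μ`
(`linearizedPow_bounds`). For `μ < 2n + 2` orthogonality to the low modes forces `P_μ ξ = 0`
(`spectralProj_eq_zero`), because every eigenfunction there is affine
(`exists_affinePoly_of_mem_eigenspace`).

That last fact is proved by moments, without decomposing `L²` into spherical harmonics. If `-Δ f = μ
f` weakly, testing with a homogeneous polynomial `p` of degree `d` gives `⟨Δ_E p, f⟩ = (d(d+n-1) -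
μ)⟨p, f⟩`, where `Δ_E` is the Euclidean Laplacian. For `d ≥ 2` and `μ < 2n + 2` the factor is
positive, so the moments of degrees 0 and 1 determine all the others. The affine function with the
same low moments obeys the same recursion, hence equals `f` by density of polynomials.

That the affine function obeys the recursion rests on `∫ ∂_i p = (d+n) ∫ ω^i p` over the sphere
(`integral_polyFun_pderiv`), obtained by integrating by parts on `ℝ^{n+1}` against a radial cutoff
and separating the radial factor. -/

/-- A polynomial in `n + 1` variables as a function on `ℝ^{n+1}`. -/
def polyFun {n : ℕ} (p : MvPolynomial (Fin (n + 1)) ℝ) (y : EuclideanSpace ℝ (Fin (n + 1))) : ℝ :=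
  eval (fun i => y i) p

/-! ### Polynomials on the sphere and their Laplace–Beltrami operator. -/

section PolyFun

variable {n : ℕ}

@[simp] theorem polyFun_add (p q : MvPolynomial (Fin (n + 1)) ℝ)
    (y : EuclideanSpace ℝ (Fin (n + 1))) : polyFun (p + q) y = polyFun p y + polyFun q y := by
  simp [polyFun]

@[simp] theorem polyFun_mul (p q : MvPolynomial (Fin (n + 1)) ℝ)
    (y : EuclideanSpace ℝ (Fin (n + 1))) : polyFun (p * q) y = polyFun p y * polyFun q y := by
  simp [polyFun]

@[simp] theorem polyFun_C (c : ℝ) (y : EuclideanSpace ℝ (Fin (n + 1))) :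
    polyFun (C c) y = c := by
  simp [polyFun]

@[simp] theorem polyFun_zero (y : EuclideanSpace ℝ (Fin (n + 1))) :
    polyFun (0 : MvPolynomial (Fin (n + 1)) ℝ) y = 0 := by
  simp [polyFun]

@[simp] theorem polyFun_one (y : EuclideanSpace ℝ (Fin (n + 1))) :
    polyFun (1 : MvPolynomial (Fin (n + 1)) ℝ) y = 1 := by
  simp [polyFun]

@[simp] theorem polyFun_X (i : Fin (n + 1)) (y : EuclideanSpace ℝ (Fin (n + 1))) :
    polyFun (X i) y = y i := by
  simp [polyFun]

@[simp] theorem polyFun_sum {ι : Type*} (s : Finset ι) (p : ι → MvPolynomial (Fin (n + 1)) ℝ)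
    (y : EuclideanSpace ℝ (Fin (n + 1))) :
    polyFun (∑ i ∈ s, p i) y = ∑ i ∈ s, polyFun (p i) y := by
  simp [polyFun]

theorem polyFun_smul {p : MvPolynomial (Fin (n + 1)) ℝ} {d : ℕ} (hp : p.IsHomogeneous d) (r : ℝ)
    (y : EuclideanSpace ℝ (Fin (n + 1))) : polyFun p (r • y) = r ^ d * polyFun p y := by
  simp only [polyFun, eval_eq, Finset.mul_sum]
  refine Finset.sum_congr rfl fun m hm => ?_
  have hd : ∑ i, m i = d := by
    have := hp (mem_support_iff.1 hm)
    rw [Finsupp.weight_apply, Finsupp.sum_fintype _ _ (by simp)] at this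
    simpa using this
  have h2 : ∏ i ∈ m.support, ((r • y) i) ^ m i = r ^ d * ∏ i ∈ m.support, (y i) ^ m i := by
    simp only [PiLp.smul_apply, smul_eq_mul, mul_pow, Finset.prod_mul_distrib]
    congr 1
    rw [Finset.prod_pow_eq_pow_sum, ← hd]
    congr 1
    exact Finset.sum_subset (Finset.subset_univ _) (by simp)
  rw [h2]
  ring

theorem hasFDerivAt_polyFun (p : MvPolynomial (Fin (n + 1)) ℝ)
    (y : EuclideanSpace ℝ (Fin (n + 1))) :
    HasFDerivAt (polyFun p)
      (∑ i, polyFun (pderiv i p) y • (EuclideanSpace.proj i : _ →L[ℝ] ℝ)) y := by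
  induction p using MvPolynomial.induction_on with
  | C a =>
    have : polyFun (C a : MvPolynomial (Fin (n + 1)) ℝ) = fun _ => a := by ext; simp
    rw [this]
    simpa using hasFDerivAt_const a y
  | add p q hp hq =>
    have : polyFun (p + q) = fun z => polyFun p z + polyFun q z := by ext; simp
    rw [this]
    refine (hp.add hq).congr_fderiv ?_
    simp [add_smul, Finset.sum_add_distrib]
  | mul_X p i hp =>
    have : polyFun (p * X i) = fun z => polyFun p z * (EuclideanSpace.proj i : _ →L[ℝ] ℝ) z := by
      ext; simp
    rw [this]
    refine (hp.mul (EuclideanSpace.proj i : _ →L[ℝ] ℝ).hasFDerivAt).congr_fderiv ?_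
    simp only [Derivation.leibniz, pderiv_X, smul_eq_mul, polyFun_add, polyFun_mul, add_smul,
      Finset.sum_add_distrib, polyFun_X, Finset.smul_sum, PiLp.proj_apply]
    congr 1
    · rw [Finset.sum_eq_single i]
      · simp
      · intro j _ hj
        simp [Pi.single_eq_of_ne' hj]
      · simp
    · simp [smul_smul]

theorem contDiff_polyFun (p : MvPolynomial (Fin (n + 1)) ℝ) {m : WithTop ℕ∞} :
    ContDiff ℝ m (polyFun p) := by
  have h := (AnalyticOnNhd.eval_continuousLinearMap'
    (fun i => (EuclideanSpace.proj i : EuclideanSpace ℝ (Fin (n + 1)) →L[ℝ] ℝ)) p)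
  exact h.contDiff

theorem continuous_polyFun (p : MvPolynomial (Fin (n + 1)) ℝ) : Continuous (polyFun p) :=
  (contDiff_polyFun p (m := 0)).continuous

theorem isSmooth_polyFun (p : MvPolynomial (Fin (n + 1)) ℝ) :
    IsSmooth (fun x : S n => polyFun p x) := by
  have := Fact.mk (@finrank_euclideanSpace_fin ℝ _ (n + 1))
  exact (contDiff_polyFun p).contMDiff.comp (contMDiff_coe_sphere (n := n))

/-- The Euclidean Laplacian of a polynomial. -/
def polyLaplacian (p : MvPolynomial (Fin (n + 1)) ℝ) : MvPolynomial (Fin (n + 1)) ℝ :=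
  ∑ i, pderiv i (pderiv i p)

theorem sum_mul_polyFun_pderiv {p : MvPolynomial (Fin (n + 1)) ℝ} {d : ℕ} (hp : p.IsHomogeneous d)
    (y : EuclideanSpace ℝ (Fin (n + 1))) :
    ∑ i, y i * polyFun (pderiv i p) y = d * polyFun p y := by
  have h := congrArg (fun q => polyFun q y) hp.sum_X_mul_pderiv
  simpa [polyFun] using h

/-- `∂_i (|y|^{2s} p) = |y|^{2(s-1)} (2 s y_i p) + |y|^{2s} ∂_i p`. -/
theorem hasFDerivAt_normSq_rpow_mul_polyFun (s : ℝ) (p : MvPolynomial (Fin (n + 1)) ℝ)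
    {y : EuclideanSpace ℝ (Fin (n + 1))} (hy : y ≠ 0) :
    ∃ L : EuclideanSpace ℝ (Fin (n + 1)) →L[ℝ] ℝ,
      HasFDerivAt (fun z => (‖z‖ ^ 2) ^ s * polyFun p z) L y ∧
      ∀ i, L (EuclideanSpace.single i 1) =
        (‖y‖ ^ 2) ^ (s - 1) * polyFun (C (2 * s) * (X i * p)) y +
          (‖y‖ ^ 2) ^ s * polyFun (pderiv i p) y := by
  have hN : ‖y‖ ^ 2 ≠ 0 := pow_ne_zero _ (norm_ne_zero_iff.2 hy)
  have h1 := (hasStrictFDerivAt_norm_sq y).hasFDerivAt.rpow_const (p := s) (Or.inl hN)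
  refine ⟨_, h1.mul (hasFDerivAt_polyFun p y), fun i => ?_⟩
  simp [EuclideanSpace.inner_single_right]
  ring

theorem radialExtension_polyFun {p : MvPolynomial (Fin (n + 1)) ℝ} {d : ℕ}
    (hp : p.IsHomogeneous d) {y : EuclideanSpace ℝ (Fin (n + 1))} (hy : y ≠ 0) :
    radialExtension (fun x : S n => polyFun p x) y =
      (‖y‖ ^ 2) ^ (-(d : ℝ) / 2) * polyFun p y := by
  simp only [radialExtension, dif_neg hy, polyFun_smul hp]
  congr 1
  rw [← Real.rpow_natCast ‖y‖ 2, ← Real.rpow_mul (norm_nonneg y), inv_pow,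
    ← Real.rpow_natCast, ← Real.rpow_neg (norm_nonneg y)]
  congr 1
  push_cast
  ring

/-- The radial extension of `p` is `|y|^{-d} p`. Differentiating it twice and using Euler's
identity, the coefficient of `p` on `|x| = 1` is `4s(s-1) + 2s(n+1) + 4sd`, which equals `-d(d+n-1)`
at `s = -d/2`. -/
theorem laplaceBeltrami_polyFun {p : MvPolynomial (Fin (n + 1)) ℝ} {d : ℕ}
    (hp : p.IsHomogeneous d) (x : S n) :
    laplaceBeltrami (fun x : S n => polyFun p x) x =
      polyFun (polyLaplacian p) x - d * (d + n - 1) * polyFun p x := by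
  obtain ⟨x, hx'⟩ := x
  have hx : ‖x‖ = 1 := by simpa using hx'
  have hx0 : x ≠ 0 := by rintro rfl; simp at hx
  set s : ℝ := -(d : ℝ) / 2 with hs
  set F : EuclideanSpace ℝ (Fin (n + 1)) → ℝ := fun z => (‖z‖ ^ 2) ^ s * polyFun p z with hF
  have hnhds : ∀ᶠ y in nhds x, y ≠ 0 := isOpen_ne.mem_nhds hx0
  have hFC : ContDiffAt ℝ 2 F x := by
    refine ContDiffAt.mul ?_ (contDiff_polyFun p).contDiffAt
    exact (contDiff_norm_sq ℝ).contDiffAt.rpow_const_of_ne (by simp [hx])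
  have key : ∀ i, iteratedFDeriv ℝ 2 F x
      ![EuclideanSpace.single i 1, EuclideanSpace.single i 1] =
      (2 * (s - 1) * (2 * s)) * (x i ^ 2 * polyFun p x) + 2 * s * polyFun p x +
        4 * s * (x i * polyFun (pderiv i p) x) + polyFun (pderiv i (pderiv i p)) x := by
    intro i
    set e : EuclideanSpace ℝ (Fin (n + 1)) := EuclideanSpace.single i 1
    rw [iteratedFDeriv_two_apply]
    simp only [Matrix.cons_val_zero, Matrix.cons_val_one]
    have hd : DifferentiableAt ℝ (fderiv ℝ F) x :=
      (hFC.fderiv_right (m := 1) (by norm_num)).differentiableAt (by norm_num)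
    have h1 : fderiv ℝ (fderiv ℝ F) x e e = fderiv ℝ (fun y => fderiv ℝ F y e) x e := by
      have := (hd.hasFDerivAt.clm_apply (hasFDerivAt_const e x)).fderiv
      rw [this]
      simp
    have h2 : (fun y => fderiv ℝ F y e) =ᶠ[nhds x] fun y =>
        (‖y‖ ^ 2) ^ (s - 1) * polyFun (C (2 * s) * (X i * p)) y +
          (‖y‖ ^ 2) ^ s * polyFun (pderiv i p) y := by
      filter_upwards [hnhds] with y hy
      obtain ⟨L, hL, hLe⟩ := hasFDerivAt_normSq_rpow_mul_polyFun s p hy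
      rw [hL.fderiv, hLe]
    obtain ⟨L1, hL1, hLe1⟩ :=
      hasFDerivAt_normSq_rpow_mul_polyFun (s - 1) (C (2 * s) * (X i * p)) hx0
    obtain ⟨L2, hL2, hLe2⟩ := hasFDerivAt_normSq_rpow_mul_polyFun s (pderiv i p) hx0
    rw [h1, h2.fderiv_eq, (hL1.fun_add hL2).fderiv, add_apply, hLe1, hLe2]
    simp only [hx, one_pow, Real.one_rpow, one_mul, polyFun_mul, polyFun_C, polyFun_X, pderiv_C,
      polyFun_zero,
      Derivation.leibniz, pderiv_X_self, smul_eq_mul, polyFun_add, polyFun_one]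
    ring
  have hlap : laplaceBeltrami (fun x : S n => polyFun p x) ⟨x, hx'⟩ =
      Laplacian.laplacian F x := by
    refine (InnerProductSpace.laplacian_congr_nhds ?_).eq_of_nhds
    filter_upwards [hnhds] with y hy
    exact radialExtension_polyFun hp hy
  rw [hlap, InnerProductSpace.laplacian_eq_iteratedFDeriv_orthonormalBasis F
    (EuclideanSpace.basisFun (Fin (n + 1)) ℝ)]
  simp only [EuclideanSpace.basisFun_apply, key, Finset.sum_add_distrib, ← Finset.mul_sum,
    ← Finset.sum_mul, sum_mul_polyFun_pderiv hp, polyLaplacian, polyFun_sum]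
  have hsum : ∑ i, x i ^ 2 = 1 := by
    rw [← EuclideanSpace.real_norm_sq_eq, hx, one_pow]
  rw [hsum]
  simp only [Finset.sum_const, Finset.card_univ, Fintype.card_fin, nsmul_eq_mul, hs]
  push_cast
  ring

end PolyFun


/-! ### Polar coordinates and integration by parts on the sphere. -/

section SphereIntegral

/-- Integration in polar coordinates of a function whose restriction to every ray is a multiple of
a fixed function `w`, against a radial weight. -/
theorem integral_mul_norm_eq {n : ℕ} {h : EuclideanSpace ℝ (Fin (n + 1)) → ℝ} {w : ℝ → ℝ}
    (hw : ∀ r > 0, ∀ y, h (r • y) = w r * h y) (g : ℝ → ℝ) :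
    ∫ y, h y * g ‖y‖ =
      (∫ x : S n, h x ∂(surfaceMeasure n)) * ∫ r in Set.Ioi (0 : ℝ), r ^ n * (w r * g r) := by
  set V : Measure (EuclideanSpace ℝ (Fin (n + 1))) := volume with hV
  have hdim : Module.finrank ℝ (EuclideanSpace ℝ (Fin (n + 1))) - 1 = n := by simp
  calc ∫ y, h y * g ‖y‖ = ∫ y : ({(0)}ᶜ : Set (EuclideanSpace ℝ (Fin (n + 1)))),
        h y * g ‖(y : EuclideanSpace ℝ (Fin (n + 1)))‖ ∂(V.comap (↑)) := by
        rw [integral_subtype_comap (measurableSet_singleton _).compl fun y => h y * g ‖y‖,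
          restrict_compl_singleton]
    _ = ∫ z : S n × Set.Ioi (0 : ℝ), h z.1 * (w z.2 * g z.2)
          ∂(V.toSphere.prod (Measure.volumeIoiPow n)) := by
        have hmp := V.measurePreserving_homeomorphUnitSphereProd
        rw [hdim] at hmp
        rw [← hmp.integral_comp (Homeomorph.measurableEmbedding _)]
        refine integral_congr_ae (Filter.Eventually.of_forall fun y => ?_)
        have hy : 0 < ‖(y : EuclideanSpace ℝ (Fin (n + 1)))‖ := norm_pos_iff.2 y.2
        have h1 := hw _ hy
          ((homeomorphUnitSphereProd (EuclideanSpace ℝ (Fin (n + 1))) y).1 :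
            EuclideanSpace ℝ (Fin (n + 1)))
        simp only [homeomorphUnitSphereProd_apply_fst_coe, smul_inv_smul₀ hy.ne',
          homeomorphUnitSphereProd_apply_snd_coe] at h1 ⊢
        rw [h1]
        ring
    _ = (∫ x : S n, h x ∂(surfaceMeasure n)) *
          ∫ r : Set.Ioi (0 : ℝ), w r * g r ∂(Measure.volumeIoiPow n) :=
        integral_prod_mul (fun x : S n => h x) (fun r : Set.Ioi (0 : ℝ) => w r * g r)
    _ = _ := by
        congr 1
        simp only [Measure.volumeIoiPow, ENNReal.ofReal]
        rw [integral_withDensity_eq_integral_smul,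
          integral_subtype_comap measurableSet_Ioi fun a => Real.toNNReal (a ^ n) • (w a * g a)]
        · refine setIntegral_congr_fun measurableSet_Ioi fun r hr => ?_
          simp only [NNReal.smul_def, Real.coe_toNNReal _ (pow_nonneg (le_of_lt hr) n), smul_eq_mul]
        · exact (measurable_subtype_coe.pow_const _).real_toNNReal

/-- A smooth cutoff function on the half line. -/
def cutoff (t : ℝ) : ℝ := Real.smoothTransition (2 - t)

theorem contDiff_cutoff {m : ℕ∞} : ContDiff ℝ m cutoff :=
  Real.smoothTransition.contDiff.comp (contDiff_const.sub contDiff_id)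

theorem cutoff_eq_zero {t : ℝ} (ht : 2 ≤ t) : cutoff t = 0 :=
  Real.smoothTransition.zero_of_nonpos (by linarith)

theorem hasDerivAt_cutoff (t : ℝ) : HasDerivAt cutoff (deriv cutoff t) t :=
  ((contDiff_cutoff (m := 1)).differentiable (by norm_num) t).hasDerivAt

theorem continuous_deriv_cutoff : Continuous (deriv cutoff) :=
  (contDiff_cutoff (m := 1)).continuous_deriv (by norm_num)

theorem continuous_cutoff : Continuous cutoff := (contDiff_cutoff (m := 0)).continuous

theorem deriv_cutoff_eq_zero {t : ℝ} (ht : 2 < t) : deriv cutoff t = 0 := by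
  have : cutoff =ᶠ[nhds t] fun _ => 0 := by
    filter_upwards [isOpen_Ioi.mem_nhds ht] with s hs using cutoff_eq_zero (le_of_lt hs)
  rw [this.deriv_eq, deriv_const]

theorem integrableOn_Ioi_of_eq_zero {f : ℝ → ℝ} (hf : Continuous f) (h0 : ∀ r, 2 < r → f r = 0) :
    IntegrableOn f (Set.Ioi 0) := by
  have h1 : IntegrableOn f (Set.Icc 0 2) := hf.integrableOn_Icc
  refine h1.of_forall_sdiff_eq_zero measurableSet_Ioi fun r hr => h0 r ?_
  by_contra h
  exact hr.2 ⟨le_of_lt hr.1, not_lt.1 h⟩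

theorem integrableOn_pow_mul_cutoff (m : ℕ) :
    IntegrableOn (fun r : ℝ => r ^ m * cutoff (r ^ 2)) (Set.Ioi 0) := by
  refine integrableOn_Ioi_of_eq_zero ((continuous_pow m).mul
    (continuous_cutoff.comp (continuous_pow 2))) fun r hr => ?_
  simp [cutoff_eq_zero (show 2 ≤ r ^ 2 by nlinarith)]

theorem integrableOn_pow_mul_deriv_cutoff (m : ℕ) :
    IntegrableOn (fun r : ℝ => r ^ m * (2 * deriv cutoff (r ^ 2))) (Set.Ioi 0) := by
  refine integrableOn_Ioi_of_eq_zero ((continuous_pow m).mul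
    (continuous_const.mul (continuous_deriv_cutoff.comp (continuous_pow 2)))) fun r hr => ?_
  simp [deriv_cutoff_eq_zero (show 2 < r ^ 2 by nlinarith)]

/-- Integrate the derivative of `r^(m+1) cutoff(r²)` over the half line; both boundary terms vanish.
-/
theorem integral_pow_mul_deriv_cutoff (m : ℕ) :
    ∫ r in Set.Ioi (0 : ℝ), r ^ (m + 2) * (2 * deriv cutoff (r ^ 2)) =
      -((m + 1) * ∫ r in Set.Ioi (0 : ℝ), r ^ m * cutoff (r ^ 2)) := by
  have hder : ∀ r ∈ Set.Ioi (0 : ℝ), HasDerivAt (fun r : ℝ => r ^ (m + 1) * cutoff (r ^ 2))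
      ((m + 1) * (r ^ m * cutoff (r ^ 2)) + r ^ (m + 2) * (2 * deriv cutoff (r ^ 2))) r := by
    intro r _
    have h1 := (hasDerivAt_cutoff (r ^ 2)).comp r (hasDerivAt_pow 2 r)
    refine ((hasDerivAt_pow (m + 1) r).mul h1).congr_deriv ?_
    simp
    ring
  have hlim : Filter.Tendsto (fun r : ℝ => r ^ (m + 1) * cutoff (r ^ 2)) Filter.atTop (nhds 0) := by
    refine tendsto_const_nhds.congr' ?_
    filter_upwards [Filter.eventually_ge_atTop (2 : ℝ)] with r hr
    simp [cutoff_eq_zero (show 2 ≤ r ^ 2 by nlinarith)]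
  have hint1 := (integrableOn_pow_mul_cutoff m).const_mul (m + 1 : ℝ)
  have h := integral_Ioi_of_hasDerivAt_of_tendsto (a := 0)
    (((continuous_pow (m + 1)).mul (continuous_cutoff.comp
      (continuous_pow 2))).continuousWithinAt) hder
    (hint1.add (integrableOn_pow_mul_deriv_cutoff (m + 2))) hlim
  rw [integral_add hint1 (integrableOn_pow_mul_deriv_cutoff (m + 2)), integral_const_mul] at h
  simp at h
  linarith

theorem integral_pow_mul_cutoff_pos (m : ℕ) :
    0 < ∫ r in Set.Ioi (0 : ℝ), r ^ m * cutoff (r ^ 2) := by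
  have hnn : ∀ r ∈ Set.Ioi (0 : ℝ), 0 ≤ r ^ m * cutoff (r ^ 2) := fun r hr =>
    mul_nonneg (pow_nonneg (le_of_lt hr) _) (Real.smoothTransition.nonneg _)
  rw [setIntegral_pos_iff_support_of_nonneg_ae
    ((ae_restrict_iff' measurableSet_Ioi).2 (Filter.Eventually.of_forall hnn))
    (integrableOn_pow_mul_cutoff m)]
  refine lt_of_lt_of_le (b := volume (Set.Ioo (0 : ℝ) 1)) (by simp) (measure_mono fun r hr => ?_)
  refine ⟨mul_ne_zero (pow_ne_zero _ hr.1.ne') (ne_of_gt ?_), hr.1⟩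
  exact Real.smoothTransition.pos_of_pos (by nlinarith [hr.1, hr.2])

variable {n : ℕ}

theorem fderiv_polyFun_single (p : MvPolynomial (Fin (n + 1)) ℝ) (i : Fin (n + 1))
    (y : EuclideanSpace ℝ (Fin (n + 1))) :
    fderiv ℝ (polyFun p) y (EuclideanSpace.single i 1) = polyFun (pderiv i p) y := by
  rw [(hasFDerivAt_polyFun p y).fderiv]
  simp

/-- Integration by parts against a radial cutoff function. -/
theorem integral_pderiv_mul_cutoff (p : MvPolynomial (Fin (n + 1)) ℝ) (i : Fin (n + 1)) :
    ∫ y : EuclideanSpace ℝ (Fin (n + 1)), polyFun (pderiv i p) y * cutoff (‖y‖ ^ 2) =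
      -∫ y : EuclideanSpace ℝ (Fin (n + 1)),
        polyFun (X i * p) y * (2 * deriv cutoff (‖y‖ ^ 2)) := by
  set e : EuclideanSpace ℝ (Fin (n + 1)) := EuclideanSpace.single i 1 with he
  set g : EuclideanSpace ℝ (Fin (n + 1)) → ℝ := fun y => cutoff (‖y‖ ^ 2) with hg
  -- Composing with the squared norm keeps the cutoff differentiable at the origin.
  have hgC : ContDiff ℝ 1 g := (contDiff_cutoff (m := 1)).comp (contDiff_norm_sq ℝ)
  have hgs : HasCompactSupport g := by
    refine HasCompactSupport.intro (isCompact_closedBall 0 2) fun y hy => ?_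
    have : 2 < ‖y‖ := by simpa using hy
    exact cutoff_eq_zero (by nlinarith)
  have hg' : ∀ y, fderiv ℝ g y e = y i * (2 * deriv cutoff (‖y‖ ^ 2)) := by
    intro y
    have h := (hasDerivAt_cutoff (‖y‖ ^ 2)).comp_hasFDerivAt y
      (hasStrictFDerivAt_norm_sq y).hasFDerivAt
    rw [show g = cutoff ∘ fun y => ‖y‖ ^ 2 from rfl, h.fderiv]
    simp [he, EuclideanSpace.inner_single_right]
    ring
  have hp := continuous_polyFun p
  have hfd : Continuous fun y => fderiv ℝ g y e :=
    (hgC.continuous_fderiv (by norm_num)).clm_apply continuous_const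
  have hfds : HasCompactSupport fun y => fderiv ℝ g y e := hgs.fderiv_apply ℝ e
  have h := integral_mul_fderiv_eq_neg_fderiv_mul_of_integrable (μ := volume)
    (f := polyFun p) (g := g) (v := e)
    (by
      simp only [he, fderiv_polyFun_single]
      exact ((continuous_polyFun _).mul hgC.continuous).integrable_of_hasCompactSupport
        hgs.mul_left)
    ((hp.mul hfd).integrable_of_hasCompactSupport hfds.mul_left)
    ((hp.mul hgC.continuous).integrable_of_hasCompactSupport hgs.mul_left)
    (fun y _ => (hasFDerivAt_polyFun p y).differentiableAt)
    (fun y _ => hgC.differentiable (by norm_num) y)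
  simp only [hg'] at h
  simp only [he, fderiv_polyFun_single] at h
  rw [← neg_eq_iff_eq_neg, ← h]
  refine integral_congr_ae (Filter.Eventually.of_forall fun y => ?_)
  simp
  ring

/-- The extra factor `r` avoids the exponent `d - 1`, so that `d = 0` is covered as well. -/
theorem mul_polyFun_pderiv_smul {p : MvPolynomial (Fin (n + 1)) ℝ} {d : ℕ}
    (hp : p.IsHomogeneous d) (i : Fin (n + 1)) (r : ℝ) (y : EuclideanSpace ℝ (Fin (n + 1))) :
    r * polyFun (pderiv i p) (r • y) = r ^ d * polyFun (pderiv i p) y := by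
  rcases d with _ | d
  · have : pderiv i p = 0 := by
      rw [totalDegree_eq_zero_iff_eq_C.1 ((totalDegree_zero_iff_isHomogeneous _).2 hp), pderiv_C]
    simp [this]
  · rw [polyFun_smul hp.pderiv, ← mul_assoc, Nat.add_sub_cancel, pow_succ']

/-- `∫ ∂_i p = (d + n) ∫ ω^i p` on `S^n` for homogeneous polynomials `p` of degree `d`. -/
theorem integral_polyFun_pderiv (hn : 1 ≤ n) {p : MvPolynomial (Fin (n + 1)) ℝ} {d : ℕ}
    (hp : p.IsHomogeneous d) (i : Fin (n + 1)) :
    ∫ x : S n, polyFun (pderiv i p) x ∂(surfaceMeasure n) =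
      (d + n) * ∫ x : S n, polyFun (X i * p) x ∂(surfaceMeasure n) := by
  have h := integral_pderiv_mul_cutoff p i
  rw [integral_mul_norm_eq (w := fun r => r ^ d / r) _ (fun r => cutoff (r ^ 2)),
    integral_mul_norm_eq (w := fun r => r ^ (1 + d)) _ (fun r => 2 * deriv cutoff (r ^ 2))] at h
  -- Since `n ≥ 1`, the Jacobian `r^n` absorbs the division by `r` in the homogeneity of `∂_i p`,
  -- leaving natural exponents.
  · obtain ⟨m, rfl⟩ : ∃ m, n = m + 1 := ⟨n - 1, by omega⟩
    have h1 : ∫ r in Set.Ioi (0 : ℝ), r ^ (m + 1) * (r ^ d / r * cutoff (r ^ 2)) =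
        ∫ r in Set.Ioi (0 : ℝ), r ^ (m + d) * cutoff (r ^ 2) := by
      refine setIntegral_congr_fun measurableSet_Ioi fun r hr => ?_
      have : r ≠ 0 := ne_of_gt hr
      field_simp
      ring
    have h2 : ∫ r in Set.Ioi (0 : ℝ), r ^ (m + 1) * (r ^ (1 + d) * (2 * deriv cutoff (r ^ 2))) =
        ∫ r in Set.Ioi (0 : ℝ), r ^ (m + d + 2) * (2 * deriv cutoff (r ^ 2)) := by
      refine setIntegral_congr_fun measurableSet_Ioi fun r _ => ?_
      ring
    rw [h1, h2, integral_pow_mul_deriv_cutoff] at h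
    -- The radial integral is positive, hence cancels; the factor `m + d + 1` it leaves is `d + n`.
    refine mul_right_cancel₀ (integral_pow_mul_cutoff_pos (m + d)).ne' ?_
    rw [h]
    push_cast
    ring
  · intro r _ y
    exact polyFun_smul ((isHomogeneous_X ℝ i).mul hp) r y
  · intro r hr y
    have := mul_polyFun_pderiv_smul hp i r y
    field_simp
    linarith

end SphereIntegral


/-! ### Moments of eigenfunctions and the spectral gap. -/

section Moments

variable {n : ℕ}

/-- The restriction of a polynomial to the sphere, as an element of `L²(S^n)`. -/
def polyLp (n : ℕ) : MvPolynomial (Fin (n + 1)) ℝ →ₗ[ℝ] L2 n where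
  toFun p := (memLp_of_continuous (isSmooth_polyFun p).continuous).toLp _
  map_add' p q := by
    rw [← MemLp.toLp_add]
    exact MemLp.toLp_congr _ _ (Filter.Eventually.of_forall fun x => by simp)
  map_smul' c p := by
    rw [RingHom.id_apply, ← MemLp.toLp_const_smul]
    exact MemLp.toLp_congr _ _ (Filter.Eventually.of_forall fun x => by simp [smul_eq_C_mul])

theorem inner_polyLp (p : MvPolynomial (Fin (n + 1)) ℝ) (f : L2 n) :
    inner ℝ (polyLp n p) f = ∫ x : S n, f x * polyFun p x ∂(surfaceMeasure n) :=
  (integral_mul_eq_inner f (isSmooth_polyFun p).continuous).symm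

/-- The integral over the sphere, as a linear functional on polynomials. -/
def sphereIntegral (n : ℕ) : MvPolynomial (Fin (n + 1)) ℝ →ₗ[ℝ] ℝ :=
  (innerSL ℝ (polyLp n 1)).toLinearMap ∘ₗ polyLp n

theorem inner_polyLp_polyLp (p q : MvPolynomial (Fin (n + 1)) ℝ) :
    inner ℝ (polyLp n p) (polyLp n q) = ∫ x : S n, polyFun (q * p) x ∂(surfaceMeasure n) := by
  rw [inner_polyLp]
  refine integral_congr_ae ?_
  filter_upwards [(memLp_of_continuous (isSmooth_polyFun q).continuous).coeFn_toLp] with x hx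
  rw [polyFun_mul]
  congr 1

theorem sphereIntegral_apply (p : MvPolynomial (Fin (n + 1)) ℝ) :
    sphereIntegral n p = ∫ x : S n, polyFun p x ∂(surfaceMeasure n) := by
  rw [← mul_one p, ← inner_polyLp_polyLp, mul_one]
  rfl

theorem inner_polyLp_eq_sphereIntegral (p q : MvPolynomial (Fin (n + 1)) ℝ) :
    inner ℝ (polyLp n p) (polyLp n q) = sphereIntegral n (q * p) := by
  rw [inner_polyLp_polyLp, sphereIntegral_apply]

theorem sphereIntegral_one_pos : 0 < sphereIntegral n 1 := by
  have : sphereIntegral n 1 = (surfaceMeasure n).real Set.univ := by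
    simp [sphereIntegral_apply]
  rw [this, Measure.toSphere_real_apply_univ]
  have h := Metric.measure_ball_pos (volume : Measure (EuclideanSpace ℝ (Fin (n + 1)))) 0 one_pos
  have h2 : 0 < (volume : Measure (EuclideanSpace ℝ (Fin (n + 1)))).real (Metric.ball 0 1) :=
    ENNReal.toReal_pos h.ne' measure_ball_lt_top.ne
  have h3 : 0 < (Module.finrank ℝ (EuclideanSpace ℝ (Fin (n + 1))) : ℝ) := by
    simp only [finrank_euclideanSpace_fin]
    positivity
  positivity

theorem sphereIntegral_pderiv (hn : 1 ≤ n) {p : MvPolynomial (Fin (n + 1)) ℝ} {d : ℕ}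
    (hp : p.IsHomogeneous d) (i : Fin (n + 1)) :
    sphereIntegral n (pderiv i p) = (d + n) * sphereIntegral n (X i * p) := by
  simpa only [sphereIntegral_apply] using integral_polyFun_pderiv hn hp i

theorem pderiv_eq_zero_of_isHomogeneous_zero {p : MvPolynomial (Fin (n + 1)) ℝ}
    (hp : p.IsHomogeneous 0) (i : Fin (n + 1)) : pderiv i p = 0 := by
  rw [totalDegree_eq_zero_iff_eq_C.1 ((totalDegree_zero_iff_isHomogeneous _).2 hp), pderiv_C]

/-- The integral over `S^n` of the Laplace–Beltrami operator applied to a homogeneous polynomial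
vanishes. -/
theorem sphereIntegral_polyLaplacian (hn : 1 ≤ n) {p : MvPolynomial (Fin (n + 1)) ℝ} {d : ℕ}
    (hp : p.IsHomogeneous d) :
    sphereIntegral n (polyLaplacian p) = d * (d + n - 1) * sphereIntegral n p := by
  rcases d with _ | d
  · simp [polyLaplacian, pderiv_eq_zero_of_isHomogeneous_zero hp]
  -- Each `∂_i p` has degree one less, so it contributes the factor `d + n` in the shifted index;
  -- Euler's identity sums the remaining integrals.
  · have h := congrArg (sphereIntegral n) hp.sum_X_mul_pderiv
    rw [map_sum, map_nsmul, nsmul_eq_mul] at h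
    rw [polyLaplacian, map_sum, Finset.sum_congr rfl fun i _ =>
      sphereIntegral_pderiv hn (hp.pderiv (i := i)) i, ← Finset.mul_sum, h]
    push_cast [Nat.add_sub_cancel]
    ring

theorem polyLaplacian_X_mul (j : Fin (n + 1)) (p : MvPolynomial (Fin (n + 1)) ℝ) :
    polyLaplacian (X j * p) = X j * polyLaplacian p + (2 : ℝ) • pderiv j p := by
  have h : ∀ i, pderiv i (pderiv i (X j * p)) =
      X j * pderiv i (pderiv i p) + if i = j then (2 : ℝ) • pderiv j p else 0 := by
    intro i
    by_cases hij : i = j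
    · subst hij
      simp only [Derivation.leibniz, pderiv_X_self, smul_eq_mul, map_add, mul_one, if_true, two_smul]
      ring
    · simp [Derivation.leibniz, pderiv_X_of_ne (Ne.symm hij), hij]
  simp only [polyLaplacian, h, Finset.sum_add_distrib, Finset.mul_sum]
  simp

/-- The coordinate functions are eigenfunctions of `-Δ` for `n`, tested against polynomials. -/
theorem sphereIntegral_X_mul_polyLaplacian (hn : 1 ≤ n) {p : MvPolynomial (Fin (n + 1)) ℝ} {d : ℕ}
    (hp : p.IsHomogeneous d) (j : Fin (n + 1)) :
    sphereIntegral n (X j * polyLaplacian p) =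
      (d * (d + n - 1) - n) * sphereIntegral n (X j * p) := by
  -- In degree `d + 1` the factor is `(d+1)(d+n)`; removing the cross term `2(d+n)` leaves
  -- `(d-1)(d+n) = d(d+n-1) - n`.
  have h := sphereIntegral_polyLaplacian hn ((isHomogeneous_X ℝ j).mul hp)
  rw [polyLaplacian_X_mul, map_add, map_smul, smul_eq_mul, sphereIntegral_pderiv hn hp] at h
  push_cast at h
  linarith

theorem sphereIntegral_X (hn : 1 ≤ n) (j : Fin (n + 1)) : sphereIntegral n (X j) = 0 := by
  have h := sphereIntegral_pderiv hn (isHomogeneous_one (Fin (n + 1)) ℝ) j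
  rw [pderiv_one, map_zero, mul_one] at h
  have : (n : ℝ) ≠ 0 := by positivity
  simpa [this] using h.symm

theorem sphereIntegral_X_mul_X (hn : 1 ≤ n) (j i : Fin (n + 1)) :
    (n + 1) * sphereIntegral n (X j * X i) = if j = i then sphereIntegral n 1 else 0 := by
  have h := sphereIntegral_pderiv hn (isHomogeneous_X ℝ i) j
  split_ifs with hij
  · subst hij
    rw [pderiv_X_self] at h
    rw [h]
    push_cast
    ring
  · rw [pderiv_X_of_ne (Ne.symm hij), map_zero] at h
    rw [h]
    push_cast
    ring

theorem isHomogeneous_polyLaplacian {p : MvPolynomial (Fin (n + 1)) ℝ} {d : ℕ}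
    (hp : p.IsHomogeneous d) : (polyLaplacian p).IsHomogeneous (d - 2) :=
  IsHomogeneous.sum _ _ _ fun _ _ => hp.pderiv.pderiv

/-- The polynomials are dense in `L²(S^n)`. -/
theorem denseRange_polyLp : DenseRange (polyLp n) := by
  let co : Fin (n + 1) → C(S n, ℝ) := fun i =>
    ⟨fun x => (x : EuclideanSpace ℝ (Fin (n + 1))) i, by fun_prop⟩
  have hev : ∀ p x, aeval co p x = polyFun p (x : EuclideanSpace ℝ (Fin (n + 1))) := by
    intro p x
    induction p using MvPolynomial.induction_on with
    | C a => simp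
    | add p q hp hq => simp [hp, hq]
    | mul_X p i hp => simp [hp, co]
  have hsep : (aeval co : MvPolynomial (Fin (n + 1)) ℝ →ₐ[ℝ] C(S n, ℝ)).range.SeparatesPoints := by
    intro x y hxy
    obtain ⟨i, hi⟩ : ∃ i, (x : EuclideanSpace ℝ (Fin (n + 1))) i ≠
        (y : EuclideanSpace ℝ (Fin (n + 1))) i := by
      by_contra! h
      exact hxy (Subtype.ext (PiLp.ext h))
    exact ⟨co i, ⟨co i, ⟨X i, by simp⟩, rfl⟩, hi⟩
  have hd : DenseRange (aeval co : MvPolynomial (Fin (n + 1)) ℝ →ₐ[ℝ] C(S n, ℝ)) := by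
    -- Stone–Weierstrass gives density in `C(S n, ℝ)`, which is in turn dense in `L²`.
    have h := ContinuousMap.subalgebra_topologicalClosure_eq_top_of_separatesPoints _ hsep
    intro u
    have hu : u ∈
        (aeval co : MvPolynomial (Fin (n + 1)) ℝ →ₐ[ℝ] C(S n, ℝ)).range.topologicalClosure :=
      h ▸ Algebra.mem_top
    rwa [← SetLike.mem_coe, Subalgebra.topologicalClosure_coe, AlgHom.coe_range] at hu
  have h2 := (ContinuousMap.toLp_denseRange ℝ (surfaceMeasure n) ℝ (p := 2) (by simp)).comp hd
    (ContinuousLinearMap.continuous _)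
  convert h2 using 1
  ext1 p
  refine Lp.ext ?_
  filter_upwards [(memLp_of_continuous (isSmooth_polyFun p).continuous).coeFn_toLp,
    ContinuousMap.coeFn_toLp (p := 2) (𝕜 := ℝ) (surfaceMeasure n) (aeval co p)] with x h1 h3
  exact h1.trans ((hev p x).symm.trans h3.symm)

theorem eq_zero_of_forall_inner_polyLp {g : L2 n}
    (h : ∀ d : ℕ, ∀ p : MvPolynomial (Fin (n + 1)) ℝ, p.IsHomogeneous d →
      inner ℝ (polyLp n p) g = 0) : g = 0 := by
  have h1 : ∀ u : L2 n, inner ℝ u g = 0 := fun u =>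
    denseRange_polyLp.induction_on u (isClosed_eq (by fun_prop) (by fun_prop)) fun p => by
      rw [← sum_homogeneousComponent p, map_sum, sum_inner]
      exact Finset.sum_eq_zero fun d _ => h d _ (homogeneousComponent_isHomogeneous d p)
  exact inner_self_eq_zero.1 (h1 g)

/-- This is the moment recursion: the weak eigenvalue equation tested with `p`, its Laplace–Beltrami
image being given by `laplaceBeltrami_polyFun`. -/
theorem inner_polyLaplacian_of_mem_eigenspace {μ : ℝ} {f : L2 n} (hf : f ∈ eigenspace n μ)
    {p : MvPolynomial (Fin (n + 1)) ℝ} {d : ℕ} (hp : p.IsHomogeneous d) :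
    inner ℝ (polyLp n (polyLaplacian p)) f =
      (d * (d + n - 1) - μ) * inner ℝ (polyLp n p) f := by
  have h := (hasWeakLaplacian_iff f (-(μ • f))).1 hf _ (isSmooth_polyFun p)
  have h1 : (memLp_of_continuous (isSmooth_polyFun p).continuous_laplaceBeltrami).toLp _ =
      polyLp n (polyLaplacian p - (d * (d + n - 1) : ℝ) • p) := by
    refine MemLp.toLp_congr _ (memLp_of_continuous (isSmooth_polyFun _).continuous)
      (Filter.Eventually.of_forall fun x => ?_)
    rw [laplaceBeltrami_polyFun hp]
    simp [polyFun, smul_eval]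
  have h2 : (memLp_of_continuous (isSmooth_polyFun p).continuous).toLp _ = polyLp n p := rfl
  rw [h1, h2, map_sub, map_smul, inner_sub_left, inner_smul_left, inner_neg_right,
    inner_smul_right] at h
  simp only [conj_trivial] at h
  linarith

/-- The affine function with constant term `A` and linear coefficients `B`. -/
def affinePoly (A : ℝ) (B : Fin (n + 1) → ℝ) : MvPolynomial (Fin (n + 1)) ℝ :=
  A • 1 + ∑ i, B i • X i

theorem inner_affinePoly (A : ℝ) (B : Fin (n + 1) → ℝ) (p : MvPolynomial (Fin (n + 1)) ℝ) :
    inner ℝ (polyLp n p) (polyLp n (affinePoly A B)) =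
      A * sphereIntegral n p + ∑ i, B i * sphereIntegral n (X i * p) := by
  rw [inner_polyLp_eq_sphereIntegral]
  simp [affinePoly, add_mul, Finset.sum_mul]

/-- Below the second positive eigenvalue `2 n + 2`, all eigenfunctions of `-Δ` are affine. -/
theorem exists_affinePoly_of_mem_eigenspace (hn : 1 ≤ n) {μ : ℝ} (hμ : μ < 2 * n + 2) {f : L2 n}
    (hf : f ∈ eigenspace n μ) : ∃ A B, f = polyLp n (affinePoly A B) := by
  have hI := sphereIntegral_one_pos (n := n)
  set I := sphereIntegral n 1 with hIdef
  -- `A` and `B` match the moments of degrees 0 and 1; the factor `n + 1` reflects `∫ (ω^i)² = I /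
  -- (n + 1)`.
  set A : ℝ := inner ℝ (polyLp n 1) f / I with hA
  set B : Fin (n + 1) → ℝ := fun i => (n + 1) * inner ℝ (polyLp n (X i)) f / I with hB
  -- The recursion in degree 0 makes `A` vanish unless `μ = 0`; in degree 1 it makes `B` vanish
  -- unless `μ = n`. Hence no case split on `μ` is needed.
  have hA' : μ * A = 0 := by
    have h := inner_polyLaplacian_of_mem_eigenspace hf (isHomogeneous_one (Fin (n + 1)) ℝ)
    have h2 : polyLaplacian (1 : MvPolynomial (Fin (n + 1)) ℝ) = 0 := by simp [polyLaplacian]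
    rw [h2, map_zero, inner_zero_left] at h
    have h3 : μ * inner ℝ (polyLp n 1) f = 0 := by
      push_cast at h
      linarith
    rw [hA, ← mul_div_assoc, h3, zero_div]
  have hB' : ∀ i, (n - μ) * B i = 0 := by
    intro i
    have h := inner_polyLaplacian_of_mem_eigenspace hf (isHomogeneous_X ℝ i)
    have h2 : polyLaplacian (X i : MvPolynomial (Fin (n + 1)) ℝ) = 0 := by
      refine Finset.sum_eq_zero fun j _ => ?_
      exact pderiv_eq_zero_of_isHomogeneous_zero (isHomogeneous_X ℝ i).pderiv j
    rw [h2, map_zero, inner_zero_left] at h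
    have h3 : (n - μ) * inner ℝ (polyLp n (X i)) f = 0 := by
      push_cast at h
      linarith
    rw [hB]
    linear_combination (n + 1) / I * h3
  refine ⟨A, B, sub_eq_zero.1 (eq_zero_of_forall_inner_polyLp fun d => ?_)⟩
  have h1 : inner ℝ (polyLp n 1) (f - polyLp n (affinePoly A B)) = 0 := by
    rw [inner_sub_right, inner_affinePoly]
    simp only [mul_one, sphereIntegral_X hn, mul_zero, Finset.sum_const_zero, hA]
    field_simp
    ring
  have hX : ∀ j, inner ℝ (polyLp n (X j)) (f - polyLp n (affinePoly A B)) = 0 := by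
    intro j
    have hs : ∑ i, B i * sphereIntegral n (X i * X j) = B j * I / (n + 1) := by
      rw [Finset.sum_eq_single j]
      · have := sphereIntegral_X_mul_X hn j j
        rw [if_pos rfl] at this
        rw [hIdef, ← this]
        field_simp
      · intro i _ hij
        have := sphereIntegral_X_mul_X hn i j
        rw [if_neg hij] at this
        rw [(mul_eq_zero.1 this).resolve_left (by positivity), mul_zero]
      · simp
    rw [inner_sub_right, inner_affinePoly, sphereIntegral_X hn, hs, hB]
    field_simp
    ring
  induction d using Nat.strong_induction_on with
  | _ d ih =>
    intro p hp
    match d, ih, hp with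
    | 0, _, hp =>
      rw [totalDegree_eq_zero_iff_eq_C.1 ((totalDegree_zero_iff_isHomogeneous _).2 hp),
        ← mul_one (C _), ← smul_eq_C_mul, map_smul, inner_smul_left, h1, mul_zero]
    | 1, _, hp =>
      have h := hp.sum_X_mul_pderiv
      rw [one_nsmul] at h
      rw [← h, map_sum, sum_inner]
      refine Finset.sum_eq_zero fun i _ => ?_
      rw [totalDegree_eq_zero_iff_eq_C.1
        ((totalDegree_zero_iff_isHomogeneous _).2 (hp.pderiv (i := i))),
        mul_comm, ← smul_eq_C_mul, map_smul, inner_smul_left, hX, mul_zero]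
    | d + 2, ih, hp =>
      have h := ih d (by omega) _ (isHomogeneous_polyLaplacian hp)
      have hf' := inner_polyLaplacian_of_mem_eigenspace hf hp
      -- The affine function satisfies the same recursion; `hA'` and `hB'` absorb the difference
      -- between `μ` and the eigenvalues 0 and `n`.
      have hq : inner ℝ (polyLp n (polyLaplacian p)) (polyLp n (affinePoly A B)) =
          (((d + 2 : ℕ) : ℝ) * ((d + 2 : ℕ) + n - 1) - μ) *
            inner ℝ (polyLp n p) (polyLp n (affinePoly A B)) := by
        rw [inner_affinePoly, inner_affinePoly, sphereIntegral_polyLaplacian hn hp, mul_add,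
          Finset.mul_sum]
        congr 1
        · linear_combination sphereIntegral n p * hA'
        · refine Finset.sum_congr rfl fun i _ => ?_
          rw [sphereIntegral_X_mul_polyLaplacian hn hp]
          linear_combination (-sphereIntegral n (X i * p)) * hB' i
      rw [inner_sub_right, hf', hq, ← mul_sub, ← inner_sub_right] at h
      -- The factor is at least its value `2(n + 1) - μ` in degree two, which is where `μ < 2n + 2`
      -- enters.
      refine (mul_eq_zero.1 h).resolve_left (ne_of_gt ?_)
      push_cast
      have : (0 : ℝ) ≤ d := d.cast_nonneg
      have : (0 : ℝ) ≤ n := n.cast_nonneg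
      nlinarith

theorem OrthogonalToLowModes.inner_affinePoly {ξ : L2 n} (hξ : OrthogonalToLowModes ξ) (A : ℝ)
    (B : Fin (n + 1) → ℝ) : inner ℝ (polyLp n (affinePoly A B)) ξ = 0 := by
  have h1 : inner ℝ (polyLp n 1) ξ = 0 := by
    rw [inner_polyLp]
    simpa using hξ.1
  have hX : ∀ j, inner ℝ (polyLp n (X j)) ξ = 0 := fun j => by
    rw [inner_polyLp]
    simpa using hξ.2 j
  simp [affinePoly, inner_add_left, sum_inner, inner_smul_left, h1, hX]

theorem spectralProj_eq_zero (hn : 1 ≤ n) {ξ : L2 n} (hξ : OrthogonalToLowModes ξ) {μ : ℝ}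
    (hμ : μ < 2 * n + 2) : spectralProj n μ ξ = 0 := by
  rw [spectralProj, Submodule.starProjection_apply_eq_zero_iff, Submodule.mem_orthogonal]
  intro f hf
  obtain ⟨A, B, rfl⟩ := exists_affinePoly_of_mem_eigenspace hn hμ hf
  exact hξ.inner_affinePoly A B

end Moments

/-! ### Comparison of the symbols and the conclusion. -/

/-- The quotient `(μ - 2n)/(1 + μ)` increases in `μ`, is `2/(2n+3)` at `μ = 2n + 2`, and stays below
1; this gives both constants. -/
theorem linearizedPow_bounds {n : ℕ} (hn : 1 ≤ n) {k : ℝ} (hk : 0 ≤ k) {a : ℝ} (ha : 0 < a) {μ : ℝ}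
    (hμ : 2 * n + 2 ≤ μ) :
    (2 / ((2 * n + 3) * n)) ^ k * a ^ k * (1 + μ) ^ k ≤ linearizedPow n a k μ ∧
      linearizedPow n a k μ ≤ (1 / n : ℝ) ^ k * a ^ k * (1 + μ) ^ k := by
  have hn' : (1 : ℝ) ≤ n := by exact_mod_cast hn
  have hn0 : (0 : ℝ) < n := by linarith
  have hμ0 : 0 ≤ 1 + μ := by linarith
  rw [linearizedPow, ← Real.mul_rpow (by positivity) ha.le, ← Real.mul_rpow (by positivity) hμ0,
    ← Real.mul_rpow (by positivity) ha.le, ← Real.mul_rpow (by positivity) hμ0]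
  have hlow : 2 * (1 + μ) / (2 * n + 3) ≤ μ - 2 * n := by
    rw [div_le_iff₀ (by positivity)]
    nlinarith
  constructor
  · refine Real.rpow_le_rpow (by positivity) ?_ hk
    calc 2 / ((2 * n + 3) * n) * a * (1 + μ) = a / n * (2 * (1 + μ) / (2 * n + 3)) := by
          field_simp
      _ ≤ _ := by gcongr
  · refine Real.rpow_le_rpow (mul_nonneg (by positivity) (by linarith)) ?_ hk
    calc a / n * (μ - 2 * n) ≤ a / n * (1 + μ) := by gcongr; linarith
      _ = _ := by ring

end RoundSphere

end

theorem mainTheorem5 (n : ℕ) (hn : 1 ≤ n) (k : ℝ) (hk : 1 ≤ k) :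
    ∃ c > (0 : ℝ), ∃ C > (0 : ℝ), ∀ a : ℝ, 0 < a → ∀ ξ : RoundSphere.L2 n,
      RoundSphere.MemSobolev k ξ → RoundSphere.OrthogonalToLowModes ξ →
        RoundSphere.InFormDomain (RoundSphere.linearizedPow n a k) ξ ∧
        c * a ^ k * RoundSphere.sobolevNorm k ξ ^ 2 ≤ RoundSphere.lyapunov a k ξ ∧
        RoundSphere.lyapunov a k ξ ≤ C * a ^ k * RoundSphere.sobolevNorm k ξ ^ 2 := by
  have hn0 : (0 : ℝ) < n := by exact_mod_cast hn
  refine ⟨1 / 2 * (2 / ((2 * n + 3) * n)) ^ k, by positivity, 1 / 2 * (1 / n) ^ k, by positivity,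
    fun a ha ξ hS hξ => ?_⟩
  set c : ℝ := (2 / ((2 * n + 3) * n)) ^ k
  set C : ℝ := (1 / n) ^ k
  set s : ℝ → ℝ := fun μ => (1 + μ) ^ k * ‖RoundSphere.spectralProj n μ ξ‖ ^ 2 with hs
  set t : ℝ → ℝ := fun μ =>
    RoundSphere.linearizedPow n a k μ * ‖RoundSphere.spectralProj n μ ξ‖ ^ 2 with ht
  -- The sums run over all real `μ`. Below `2n + 2` both terms vanish, so the values of `rpow` at
  -- negative bases play no role.
  have hall : ∀ μ, 0 ≤ s μ ∧ c * a ^ k * s μ ≤ t μ ∧ t μ ≤ C * a ^ k * s μ := by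
    intro μ
    rcases lt_or_ge μ (2 * n + 2) with hμ | hμ
    · simp [hs, ht, RoundSphere.spectralProj_eq_zero hn hξ hμ]
    · obtain ⟨h1, h2⟩ := RoundSphere.linearizedPow_bounds hn (by linarith : 0 ≤ k) ha hμ
      have hμ0 : 0 ≤ 1 + μ := by linarith
      refine ⟨by positivity, ?_, ?_⟩
      · simpa only [hs, ht, mul_assoc] using mul_le_mul_of_nonneg_right h1 (sq_nonneg _)
      · simpa only [hs, ht, mul_assoc] using mul_le_mul_of_nonneg_right h2 (sq_nonneg _)
  have hsS : Summable s := hS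
  have htS : Summable t := (hsS.mul_left (C * a ^ k)).of_nonneg_of_le
    (fun μ => le_trans (mul_nonneg (by positivity) (hall μ).1) (hall μ).2.1) fun μ => (hall μ).2.2
  -- Squaring undoes `Real.sqrt` only because the sum is nonnegative, which relies on the vanishing
  -- of the terms with `μ < 2n + 2`.
  have hnorm : RoundSphere.sobolevNorm k ξ ^ 2 = ∑' μ, s μ :=
    Real.sq_sqrt (tsum_nonneg fun μ => (hall μ).1)
  have hlyap : RoundSphere.lyapunov a k ξ = 1 / 2 * ∑' μ, t μ := rfl
  have h1 := (hsS.mul_left (c * a ^ k)).tsum_le_tsum (fun μ => (hall μ).2.1) htS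
  have h2 := htS.tsum_le_tsum (fun μ => (hall μ).2.2) (hsS.mul_left (C * a ^ k))
  rw [tsum_mul_left] at h1 h2
  refine ⟨htS, ?_, ?_⟩
  · rw [hnorm, hlyap]
    linarith
  · rw [hnorm, hlyap]
    linarith
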